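/- Let $n\ge 0$, $[n]=\{1,\dots,n\}$, and let $f:2^{[n]}\to\mathbb{Z}_{\ge 0}$ satisfy $f(\emptyset)=0$, $f(I)\le f(J)$ for $I\subseteq J\subseteq[n]$, and $f(I)+f(J)\ge f(I\cup J)+f(I\cap J)$ for all $I,J\subseteq[n]$. Let $$P=\Big\{a\in\mathbb{Z}_{\ge 0}^n : \sum_{i\in I}a_i\le f(I)\text{ for all } I\subseteq[n],\ \sum_{i\in[n]}a_i=f([n])\Big\}$$ be the integer polymatroid with rank function $f$, and put $g=\sum_{i\in[n]}f(\{i\})-f([n])$. Let $e_1,\dots,e_n$ be the canonical basis of $\mathbb{Z}^n$. For $a\in P$ let $\mathrm{Int}(a)$ be the set of $i\in[n]$ with $a-e_i+e_j\notin P$ for all $j<i$, and let $\mathrm{Ext}(a)$ be the set of $i\in[n]$ with $a+e_i-e_j\notin P$ for all $j<i$. The interior and exterior polynomials of $P$ are $$I_P(x)=\sum_{a\in P}x^{\,n-|\mathrm{Int}(a)|},\qquad X_P(y)=\sum_{a\in P}y^{\,n-|\mathrm{Ext}(a)|}.$$ For an integer $k\ge 0$ let $$r_k(P)=\min\{n-|F|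 : F\subseteq[n],\ f(F)\le f([n])-k\},\qquad r'_k(P)=\min\Big\{|F| : F\subseteq[n],\ \sum_{i\in F}f(\{i\})-f(F)\ge k\Big\},$$ where the minimum of the empty set is $+\infty$. A flat is a set $H\subseteq[n]$ with $f(H\cup\{x\})>f(H)$ for all $x\in[n]\setminus H$. For $j\ge 0$ let $\mathcal{H}_j(P)$ be the set of flats $H$ with $f(H)=f([n])-1$ and $n-|H|=j$, and let $\mathcal{C}_j(P)$ be the set of $C\subseteq[n]$ with $|C|=j$, $\sum_{i\in C}f(\{i\})-f(C)=1$ and $\sum_{i\in C\setminus\{l\}}f(\{i\})=f(C\setminus\{l\})$ for every $l\in C$. Write $\binom{m}{k}=m(m-1)\cdots(m-k+1)/k!$ for $m\in\mathbb{Z}$, $k\ge 0$, so that $\binom{m}{0}=1$. Then: (i) for all integers $0\le i<r_2(P)$, $$[y^i]X_P(y)=\binom{f([n])+i-1}{i}-\sum_{j=0}^{i}\binom{f([n])+i-1-j}{i-j}\,|\mathcal{H}_j(P)|;$$ (ii) for all integers $0\le i<r'_2(P)$, $$[x^i]I_P(x)=\binom{g+i-1}{i}-\sum_{j=0}^{i}\binom{g+i-1-j}{i-j}\,|\mathcal{C}_j(P)|.$$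 -/

import Mathlib

/-- An integer polymatroid on the ground set `Fin n`, given by its rank function: a normalized,
monotone, submodular function on subsets with values in the non-negative integers. -/
structure IntPolymatroid (n : ℕ) where
  /-- The rank function. -/
  rank : Finset (Fin n) → ℕ
  rank_empty : rank ∅ = 0
  rank_mono : ∀ I J : Finset (Fin n), I ⊆ J → rank I ≤ rank J
  rank_submodular : ∀ I J : Finset (Fin n), rank (I ∪ J) + rank (I ∩ J) ≤ rank I + rank J

namespace IntPolymatroid

variable {n : ℕ}

/-- The polymatroid as a set of lattice points: the non-negative integer vectors `a` with
`∑ i ∈ I, a i ≤ f I` for every `I`, and total sum `f [n]`. Its elements are the bases. -/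
def bases (P : IntPolymatroid n) : Set (Fin n → ℤ) :=
  {a | (∀ i, 0 ≤ a i) ∧ (∀ I : Finset (Fin n), ∑ i ∈ I, a i ≤ (P.rank I : ℤ)) ∧
    ∑ i, a i = (P.rank Finset.univ : ℤ)}

theorem finite_bases (P : IntPolymatroid n) : P.bases.Finite := by
  refine (Set.finite_Icc (0 : Fin n → ℤ) (fun i => (P.rank {i} : ℤ))).subset ?_
  rintro a ⟨h0, h1, -⟩
  exact ⟨h0, fun i => by simpa using h1 {i}⟩

/-- The canonical basis vector `e_i` of `ℤⁿ`. -/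
def e (i : Fin n) : Fin n → ℤ := Pi.single i 1

open Classical in
/-- The internally active indices of `a`: those `i` with `a - e_i + e_j ∉ P` for all `j < i`. -/
noncomputable def intActive (P : IntPolymatroid n) (a : Fin n → ℤ) : Finset (Fin n) :=
  Finset.univ.filter fun i => ∀ j, j < i → a - e i + e j ∉ P.bases

open Classical in
/-- The externally active indices of `a`: those `i` with `a + e_i - e_j ∉ P` for all `j < i`. -/
noncomputable def extActive (P : IntPolymatroid n) (a : Fin n → ℤ) : Finset (Fin n) :=
  Finset.univ.filter fun i => ∀ j, j < i → a + e i - e j ∉ P.bases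

/-- The interior polynomial `I_P(x) = ∑ x ^ (n - |Int(a)|)`, the sum over all bases `a`. -/
noncomputable def interiorPoly (P : IntPolymatroid n) : Polynomial ℤ :=
  ∑ a ∈ P.finite_bases.toFinset, Polynomial.X ^ (n - (P.intActive a).card)

/-- The exterior polynomial `X_P(y) = ∑ y ^ (n - |Ext(a)|)`, the sum over all bases `a`. -/
noncomputable def exteriorPoly (P : IntPolymatroid n) : Polynomial ℤ :=
  ∑ a ∈ P.finite_bases.toFinset, Polynomial.X ^ (n - (P.extActive a).card)

/-- `r_k(P)`: the minimum of `n - |F|` over the `F ⊆ [n]` with `f F ≤ f [n] - k` (as integers).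
It is `⊤` when there is no such `F`. -/
noncomputable def r (P : IntPolymatroid n) (k : ℕ) : ℕ∞ :=
  ⨅ (F : Finset (Fin n)) (_ : P.rank F + k ≤ P.rank Finset.univ), ((n - F.card : ℕ) : ℕ∞)

/-- `r'_k(P)`: the minimum of `|F|` over the `F ⊆ [n]` with `∑ i ∈ F, f {i} - f F ≥ k`
(as integers). It is `⊤` when there is no such `F`. -/
noncomputable def r' (P : IntPolymatroid n) (k : ℕ) : ℕ∞ :=
  ⨅ (F : Finset (Fin n)) (_ : P.rank F + k ≤ ∑ i ∈ F, P.rank {i}), (F.card : ℕ∞)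

/-- The closure of `I`: all elements whose addition to `I` does not change the rank. -/
def closure (P : IntPolymatroid n) (I : Finset (Fin n)) : Finset (Fin n) :=
  Finset.univ.filter fun x => P.rank (I ∪ {x}) = P.rank I

/-- A flat is a set equal to its closure. -/
def IsFlat (P : IntPolymatroid n) (I : Finset (Fin n)) : Prop := P.closure I = I

/-- A hyperplane is a flat `H` with `f H = f [n] - 1` (as integers). -/
def IsHyperplane (P : IntPolymatroid n) (H : Finset (Fin n)) : Prop :=
  P.IsFlat H ∧ P.rank H + 1 = P.rank Finset.univ

/-- A circuit is a set `C` with `∑ i ∈ C, f {i} - f C = 1` such that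
`∑ i ∈ C \ {j}, f {i} = f (C \ {j})` for every `j ∈ C`. -/
def IsCircuit (P : IntPolymatroid n) (C : Finset (Fin n)) : Prop :=
  ∑ i ∈ C, P.rank {i} = P.rank C + 1 ∧
    ∀ j ∈ C, ∑ i ∈ C \ {j}, P.rank {i} = P.rank (C \ {j})

open Classical in
/-- `H_j(P)`: the hyperplanes `H` with `n - |H| = j`. -/
noncomputable def hyperplanes (P : IntPolymatroid n) (j : ℕ) : Finset (Finset (Fin n)) :=
  Finset.univ.filter fun H => P.IsHyperplane H ∧ n - H.card = j

open Classical in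
/-- `C_j(P)`: the circuits with exactly `j` elements. -/
noncomputable def circuits (P : IntPolymatroid n) (j : ℕ) : Finset (Finset (Fin n)) :=
  Finset.univ.filter fun C => P.IsCircuit C ∧ C.card = j

/-- The integer `g = ∑ i ∈ [n], f {i} - f [n]`. -/
def g (P : IntPolymatroid n) : ℤ :=
  ∑ i, (P.rank {i} : ℤ) - (P.rank Finset.univ : ℤ)

end IntPolymatroid

open Finset

namespace IntPolymatroid

variable {n : ℕ} (P : IntPolymatroid n)

/-! Let the entries of `c` be independent geometric variables, with value `k` of probability
`y(1-y)^k`. Each spanning `c` lies over exactly one basis `a ≤ c` whose excess sits on externally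
active indices. The vectors over `a` form a product: active indices contribute `(1-y)^(a i)`, the
others `y(1-y)^(a i)`. Hence `(1-y)^f([n]) X_P(y)` is the probability of spanning
(`one_sub_X_pow_mul_exteriorPoly`). If `c` does not span, some `F` has `c(Fᶜ) < f([n]) - f(F)`.
Corank at least two costs a factor `y^(n-|F|)`, negligible below `r_2`; corank one forces `c = 0`
off a hyperplane `H`, an event of probability `y^(n-|H|)`. Dividing by `(1-y)^f([n])` gives (i).
Part (ii) is (i) for the dual polymatroid. -/

theorem mem_bases {a : Fin n → ℤ} : a ∈ P.bases ↔ (∀ i, 0 ≤ a i) ∧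
    (∀ I : Finset (Fin n), ∑ i ∈ I, a i ≤ (P.rank I : ℤ)) ∧
    ∑ i, a i = (P.rank univ : ℤ) := Iff.rfl

theorem sum_add_e_sub_e (a : Fin n → ℤ) (i j : Fin n) (I : Finset (Fin n)) :
    ∑ x ∈ I, (a + e i - e j) x =
      ∑ x ∈ I, a x + (if i ∈ I then 1 else 0) - (if j ∈ I then 1 else 0) := by
  simp [e, sum_add_distrib, sum_sub_distrib, Pi.single_apply]

/-! ### Tight sets and basis exchange -/

section Tight

variable {P} {a : Fin n → ℤ} (ha : ∀ I : Finset (Fin n), ∑ i ∈ I, a i ≤ (P.rank I : ℤ))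
include ha

theorem tight_union_inter {I J : Finset (Fin n)} (hI : ∑ i ∈ I, a i = P.rank I)
    (hJ : ∑ i ∈ J, a i = P.rank J) :
    ∑ i ∈ I ∪ J, a i = P.rank (I ∪ J) ∧ ∑ i ∈ I ∩ J, a i = P.rank (I ∩ J) := by
  have h1 := sum_union_inter (s₁ := I) (s₂ := J) (f := a)
  have h2 : (P.rank (I ∪ J) : ℤ) + P.rank (I ∩ J) ≤ P.rank I + P.rank J := by
    exact_mod_cast P.rank_submodular I J
  have h3 := ha (I ∪ J)
  have h4 := ha (I ∩ J)
  constructor <;> linarith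

/-- The union of the members of a family of tight sets is tight. -/
theorem exists_tight_cover (S : Finset (Fin n))
    (hS : ∀ i ∈ S, ∃ T : Finset (Fin n), i ∈ T ∧ ∑ x ∈ T, a x = P.rank T) :
    ∃ T : Finset (Fin n), S ⊆ T ∧ ∑ x ∈ T, a x = P.rank T := by
  induction S using Finset.induction_on with
  | empty => exact ⟨∅, by simp, by simp [P.rank_empty]⟩
  | insert i S hi ih =>
    obtain ⟨T, hT, hTt⟩ := ih fun j hj => hS j (mem_insert_of_mem hj)
    obtain ⟨U, hU, hUt⟩ := hS i (mem_insert_self i S)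
    refine ⟨T ∪ U, ?_, (tight_union_inter ha hTt hUt).1⟩
    intro x hx
    rcases mem_insert.1 hx with rfl | hx
    · exact mem_union_right _ hU
    · exact mem_union_left _ (hT hx)

/-- Tight sets containing `k` and separating it from single elements can be intersected. -/
theorem exists_tight_separating (htop : ∑ i, a i = P.rank univ) (k : Fin n) (S : Finset (Fin n))
    (hS : ∀ j ∈ S, ∃ T : Finset (Fin n), k ∈ T ∧ j ∉ T ∧ ∑ x ∈ T, a x = P.rank T) :
    ∃ T : Finset (Fin n), k ∈ T ∧ Disjoint S T ∧ ∑ x ∈ T, a x = P.rank T := by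
  induction S using Finset.induction_on with
  | empty => exact ⟨univ, by simp, by simp, htop⟩
  | insert i S hi ih =>
    obtain ⟨T, hkT, hT, hTt⟩ := ih fun j hj => hS j (mem_insert_of_mem hj)
    obtain ⟨U, hkU, hU, hUt⟩ := hS i (mem_insert_self i S)
    refine ⟨T ∩ U, by simp [hkT, hkU], ?_, (tight_union_inter ha hTt hUt).2⟩
    rw [disjoint_insert_left]
    exact ⟨by simp [hU], hT.mono_right inter_subset_left⟩

end Tight

/-- The basis exchange property. -/
theorem exists_exchange {a b : Fin n → ℤ} (ha : a ∈ P.bases) (hb : b ∈ P.bases) {k : Fin n}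
    (hk : a k < b k) : ∃ j, b j < a j ∧ a + e k - e j ∈ P.bases := by
  classical
  by_contra! hcon
  obtain ⟨ha0, ha1, ha2⟩ := ha
  obtain ⟨hb0, hb1, hb2⟩ := hb
  obtain ⟨T, hkT, hdisj, hT⟩ := exists_tight_separating ha1 ha2 k (univ.filter fun j => b j < a j) (by
    intro j hj
    have hj : b j < a j := (mem_filter.1 hj).2
    by_contra! hT
    -- Without a tight set containing `k` but not `j`, the exchange respects every rank bound; entry
    -- `j` stays nonnegative because `a j > b j ≥ 0`.
    refine hcon j hj ⟨fun i => ?_, fun I => ?_, ?_⟩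
    · have h1 := ha0 i
      have h2 := hb0 i
      simp only [Pi.add_apply, Pi.sub_apply, e, Pi.single_apply]
      split_ifs with h3 h4 h4
      · omega
      · omega
      · subst h4; omega
      · omega
    · rw [sum_add_e_sub_e]
      have h1 := ha1 I
      by_cases hkI : k ∈ I <;> by_cases hjI : j ∈ I <;> simp only [hkI, hjI, if_true, if_false]
      · omega
      · have := hT I hkI hjI
        omega
      · omega
      · omega
    · rw [sum_add_e_sub_e]
      simp [ha2])
  have hle : ∀ x ∈ T, a x ≤ b x := by
    intro x hx
    by_contra! hlt
    exact disjoint_left.1 hdisj (mem_filter.2 ⟨mem_univ x, hlt⟩) hx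
  -- The tight `T` gives `b(T) > a(T) = f(T)`, impossible for a basis.
  have := sum_lt_sum hle ⟨k, hkT, hk⟩
  have := hb1 T
  omega

/-! ### Spanning vectors and their selected bases -/

/-- A vector is spanning if it dominates a basis. -/
def Spanning (c : Fin n → ℕ) : Prop := ∃ a ∈ P.bases, ∀ i, a i ≤ c i

/-- A vector that is not spanning violates one of the rank inequalities. -/
theorem exists_of_not_spanning {c : Fin n → ℕ} (hc : ¬ P.Spanning c) :
    ∃ F : Finset (Fin n), ∑ i ∈ Fᶜ, c i + P.rank F < P.rank univ := by
  classical
  let S : Set (Fin n → ℤ) := {a | (∀ i, 0 ≤ a i) ∧ (∀ i, a i ≤ c i) ∧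
    ∀ I : Finset (Fin n), ∑ i ∈ I, a i ≤ (P.rank I : ℤ)}
  have hfin : S.Finite := (Set.finite_Icc (0 : Fin n → ℤ) (fun i => (c i : ℤ))).subset
    fun a ha => ⟨ha.1, ha.2.1⟩
  have hne : S.Nonempty := ⟨0, fun _ => le_rfl, by simp, by simp⟩
  obtain ⟨a, ⟨ha0, hac, ha1⟩, hmax⟩ := Set.exists_max_image S (fun a => ∑ i, a i) hfin hne
  -- By maximality, every index that could still grow lies in a tight set; off the union `T` of
  -- these sets, `a` agrees with `c`.
  obtain ⟨T, hT, hTt⟩ := exists_tight_cover ha1 (univ.filter fun i => a i < c i) (by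
    intro i hi
    have hi : a i < c i := (mem_filter.1 hi).2
    by_contra! hcon
    have hmem : a + e i ∈ S := by
      refine ⟨fun j => ?_, fun j => ?_, fun I => ?_⟩
      · have := ha0 j
        simp only [Pi.add_apply, e, Pi.single_apply]
        split_ifs <;> omega
      · have := hac j
        simp only [Pi.add_apply, e, Pi.single_apply]
        split_ifs with h
        · subst h; omega
        · omega
      · have h1 := ha1 I
        simp only [Pi.add_apply, e, sum_add_distrib, Pi.single_apply, sum_ite_eq']
        split_ifs with h
        · have := hcon I h; omega
        · omega
    have := hmax _ hmem
    simp [e, sum_add_distrib] at this)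
  refine ⟨T, ?_⟩
  have hcompl : ∑ i ∈ Tᶜ, a i = ∑ i ∈ Tᶜ, (c i : ℤ) := by
    refine sum_congr rfl fun i hi => le_antisymm (hac i) ?_
    by_contra! hlt
    exact (mem_compl.1 hi) (hT (mem_filter.2 ⟨mem_univ i, hlt⟩))
  have hsum := sum_add_sum_compl T a
  have hlt : ∑ i, a i < P.rank univ :=
    lt_of_le_of_ne (ha1 univ) fun h => hc ⟨a, ⟨ha0, ha1, h⟩, hac⟩
  zify
  linarith

theorem not_spanning_of_lt {c : Fin n → ℕ} {F : Finset (Fin n)}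
    (h : ∑ i ∈ Fᶜ, c i + P.rank F < P.rank univ) : ¬ P.Spanning c := by
  rintro ⟨a, ⟨-, ha1, ha2⟩, hac⟩
  have h1 := ha1 F
  have h2 := sum_add_sum_compl F a
  have h3 : ∑ i ∈ Fᶜ, a i ≤ ∑ i ∈ Fᶜ, (c i : ℤ) := sum_le_sum fun i _ => hac i
  zify at h
  linarith

/-- The basis `a` is the distinguished basis below `c`: the excess is externally active. -/
def IsSelected (a : Fin n → ℤ) (c : Fin n → ℕ) : Prop :=
  a ∈ P.bases ∧ (∀ i, a i ≤ c i) ∧ ∀ i, a i < c i → i ∈ P.extActive a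

theorem mem_extActive {a : Fin n → ℤ} {i : Fin n} :
    i ∈ P.extActive a ↔ ∀ j, j < i → a + e i - e j ∉ P.bases := by
  simp [extActive]

/-- Among the bases below `c`, take one maximizing `∑ i * a i`: replacing `a` by `a + e_i - e_j`
with `j < i` would increase it. -/
theorem Spanning.exists_isSelected {c : Fin n → ℕ} (hc : P.Spanning c) :
    ∃ a, P.IsSelected a c := by
  let S : Set (Fin n → ℤ) := {a | a ∈ P.bases ∧ ∀ i, a i ≤ c i}
  have hfin : S.Finite := P.finite_bases.subset fun a ha => ha.1
  obtain ⟨a, ⟨ha, hac⟩, hmax⟩ :=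
    Set.exists_max_image S (fun a => ∑ i : Fin n, (i : ℤ) * a i) hfin hc
  refine ⟨a, ha, hac, fun i hi => P.mem_extActive.2 fun j hj hmem => ?_⟩
  have := hmax (a + e i - e j) ⟨hmem, fun x => ?_⟩
  · simp [e, mul_add, mul_sub, sum_add_distrib, sum_sub_distrib, Pi.single_apply] at this
    omega
  · have h := hac x
    simp only [Pi.add_apply, Pi.sub_apply, e, Pi.single_apply]
    split_ifs with h1 h2 h2
    · omega
    · subst h1; omega
    · omega
    · omega

/-- At the largest index `k` where the two differ, the smaller one has room below `c`, so `k` is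
active for it; yet exchange supplies a forbidden `j < k`. -/
theorem IsSelected.unique {a b : Fin n → ℤ} {c : Fin n → ℕ} (ha : P.IsSelected a c)
    (hb : P.IsSelected b c) : a = b := by
  classical
  by_contra hne
  have hD : (univ.filter fun i => a i ≠ b i).Nonempty := by
    obtain ⟨i, hi⟩ := Function.ne_iff.1 hne
    exact ⟨i, by simpa using hi⟩
  obtain ⟨k, hk, hmax⟩ := exists_max_image _ id hD
  have key : ∀ a b : Fin n → ℤ, P.IsSelected a c → P.IsSelected b c →
      (∀ j, a j ≠ b j → j ≤ k) → ¬ a k < b k := by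
    rintro a b ⟨ha, -, hae⟩ ⟨hb, hbc, -⟩ hmax hlt
    obtain ⟨j, hj, hmem⟩ := P.exists_exchange ha hb hlt
    refine P.mem_extActive.1 (hae k (hlt.trans_le (hbc k))) j (lt_of_le_of_ne (hmax j hj.ne') ?_) hmem
    rintro rfl
    omega
  rcases lt_or_gt_of_ne (mem_filter.1 hk).2 with h | h
  · exact key a b ha hb (fun j hj => hmax j (by simpa using hj)) h
  · exact key b a hb ha (fun j hj => hmax j (by simpa using hj.symm)) h

end IntPolymatroid

/-! ### Geometric weights and the spanning probability -/

open Polynomial in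
/-- Truncated geometric weights: `y (1 - y) ^ k` for `k < M`, the remaining mass at `M`. -/
noncomputable def geomWeight (M k : ℕ) : ℤ[X] := if k < M then (1 - X) ^ k * X else (1 - X) ^ M

open Polynomial in
theorem sum_geomWeight {M a : ℕ} (h : a ≤ M) :
    ∑ k ∈ Ico a (M + 1), geomWeight M k = (1 - X) ^ a := by
  have key : ∀ m, ∑ k ∈ Ico a (a + m), ((1 - X) ^ k * X : ℤ[X]) = (1 - X) ^ a - (1 - X) ^ (a + m) := by
    intro m
    induction m with
    | zero => simp
    | succ m ih =>
      rw [← add_assoc, sum_Ico_succ_top (by omega), ih]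
      ring
  rw [sum_Ico_succ_top h]
  obtain ⟨m, rfl⟩ := Nat.exists_eq_add_of_le h
  have hlt : ∀ k ∈ Ico a (a + m), geomWeight (a + m) k = (1 - X) ^ k * X :=
    fun k hk => if_pos (mem_Ico.1 hk).2
  rw [sum_congr rfl hlt, key, geomWeight, if_neg (lt_irrefl _)]
  ring

namespace IntPolymatroid

variable {n : ℕ} (P : IntPolymatroid n)

/-- The box of all vectors with entries at most `M`. -/
def box (n M : ℕ) : Finset (Fin n → ℕ) := Fintype.piFinset fun _ => Ico 0 (M + 1)

/-- The vectors of the box for which `a` is the selected basis, as a product of intervals. -/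
noncomputable def cell (a : Fin n → ℤ) : Finset (Fin n → ℕ) :=
  -- The cutoff is `M = f([n]) + 1`. Basis entries stay below it, so an inactive index never
  -- receives the truncated weight.
  Fintype.piFinset fun i => if i ∈ P.extActive a then Ico (a i).toNat (P.rank univ + 2)
    else {(a i).toNat}

theorem apply_le_rank_univ {a : Fin n → ℤ} (ha : a ∈ P.bases) (i : Fin n) :
    a i ≤ P.rank univ := by
  have h1 := ha.2.1 {i}
  have h2 := P.rank_mono {i} univ (subset_univ _)
  rw [sum_singleton] at h1
  omega

theorem mem_cell {a : Fin n → ℤ} (ha : a ∈ P.bases) {c : Fin n → ℕ} :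
    c ∈ P.cell a ↔ c ∈ box n (P.rank univ + 1) ∧ P.IsSelected a c := by
  simp only [cell, box, Fintype.mem_piFinset, IsSelected, ha, true_and]
  rw [← forall_and, ← forall_and]
  refine forall_congr' fun i => ?_
  have h0 := ha.1 i
  have h1 := P.apply_le_rank_univ ha i
  by_cases hi : i ∈ P.extActive a
  · simp only [hi, if_true, mem_Ico, implies_true, and_true]
    omega
  · simp only [hi, if_false, mem_singleton, mem_Ico, imp_false]
    omega

open Polynomial

theorem sum_cell {a : Fin n → ℤ} (ha : a ∈ P.bases) :
    ∑ c ∈ P.cell a, ∏ i, geomWeight (P.rank univ + 1) (c i) =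
      (1 - X) ^ P.rank univ * X ^ (n - (P.extActive a).card) := by
  classical
  rw [cell, ← prod_univ_sum]
  have hi : ∀ i, ∑ k ∈ (if i ∈ P.extActive a then Ico (a i).toNat (P.rank univ + 2)
      else {(a i).toNat}), geomWeight (P.rank univ + 1) k =
      (1 - X) ^ (a i).toNat * if i ∈ P.extActive a then 1 else X := by
    intro i
    have h1 := P.apply_le_rank_univ ha i
    split_ifs with h
    · rw [sum_geomWeight (by omega), mul_one]
    · rw [sum_singleton, geomWeight, if_pos (by omega)]
  rw [prod_congr rfl fun i _ => hi i, prod_mul_distrib, prod_pow_eq_pow_sum]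
  congr 2
  · zify
    rw [← ha.2.2]
    exact sum_congr rfl fun i _ => Int.toNat_of_nonneg (ha.1 i)
  · rw [prod_ite]
    simp [filter_not, card_sdiff]

open Classical in
/-- The exterior polynomial as the probability that a vector of geometric variables spans. -/
theorem one_sub_X_pow_mul_exteriorPoly :
    (1 - X) ^ P.rank univ * P.exteriorPoly =
      ∑ c ∈ (box n (P.rank univ + 1)).filter P.Spanning,
        ∏ i, geomWeight (P.rank univ + 1) (c i) := by
  have hunion : (box n (P.rank univ + 1)).filter P.Spanning =
      P.finite_bases.toFinset.biUnion P.cell := by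
    ext c
    simp only [mem_filter, mem_biUnion, Set.Finite.mem_toFinset]
    constructor
    · rintro ⟨hc, hs⟩
      obtain ⟨a, ha⟩ := hs.exists_isSelected
      exact ⟨a, ha.1, (P.mem_cell ha.1).2 ⟨hc, ha⟩⟩
    · rintro ⟨a, ha, hc⟩
      obtain ⟨hc, hs⟩ := (P.mem_cell ha).1 hc
      exact ⟨hc, a, ha, hs.2.1⟩
  rw [hunion, sum_biUnion, exteriorPoly, mul_sum]
  · exact sum_congr rfl fun a ha => (P.sum_cell (by simpa using ha)).symm
  · intro a ha b hb hab
    refine disjoint_left.2 fun c hca hcb => hab ?_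
    exact IsSelected.unique P ((P.mem_cell (by simpa using ha)).1 hca).2
      ((P.mem_cell (by simpa using hb)).1 hcb).2

open Classical in
theorem sum_box_filter_support (M : ℕ) (hM : 0 < M) (H : Finset (Fin n)) :
    ∑ c ∈ (box n M).filter (fun c => ∀ i ∉ H, c i = 0), ∏ i, geomWeight M (c i) =
      X ^ (n - H.card) := by
  have hset : (box n M).filter (fun c => ∀ i ∉ H, c i = 0) =
      Fintype.piFinset fun i => if i ∈ H then Ico 0 (M + 1) else {0} := by
    ext c
    simp only [box, mem_filter, Fintype.mem_piFinset]
    rw [← forall_and]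
    refine forall_congr' fun i => ?_
    by_cases hi : i ∈ H
    · simp [hi]
    · simp [hi]
      omega
  have hi : ∀ i, ∑ k ∈ (if i ∈ H then Ico 0 (M + 1) else {0}), geomWeight M k =
      if i ∈ H then 1 else X := by
    intro i
    split_ifs
    · rw [sum_geomWeight (Nat.zero_le M), pow_zero]
    · rw [sum_singleton, geomWeight, if_pos hM, pow_zero, one_mul]
  rw [hset, ← prod_univ_sum, prod_congr rfl fun i _ => hi i, prod_ite]
  simp [filter_not, card_sdiff]

theorem sum_box (M : ℕ) : ∑ c ∈ box n M, ∏ i, geomWeight M (c i) = 1 := by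
  rw [box, ← prod_univ_sum, sum_geomWeight (Nat.zero_le M)]
  simp

/-! ### Hyperplanes and the probability of not spanning -/

theorem IsHyperplane.rank_lt {H : Finset (Fin n)} (hH : P.IsHyperplane H) {I : Finset (Fin n)}
    (hI : ¬ I ⊆ H) : P.rank univ ≤ P.rank (H ∪ I) := by
  obtain ⟨x, hx, hxH⟩ := not_subset.1 hI
  have hflat : x ∉ P.closure H := by rwa [hH.1]
  simp only [closure, mem_filter, mem_univ, true_and] at hflat
  have h1 := P.rank_mono H (H ∪ {x}) subset_union_left
  have h2 := P.rank_mono (H ∪ {x}) (H ∪ I) (union_subset_union_right (by simpa using hx))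
  have := hH.2
  omega

theorem IsHyperplane.rank_inter {H K : Finset (Fin n)} (hH : P.IsHyperplane H)
    (hK : P.IsHyperplane K) (hne : H ≠ K) : P.rank (H ∩ K) + 2 ≤ P.rank univ := by
  have hu : P.rank univ ≤ P.rank (H ∪ K) := by
    by_cases h : K ⊆ H
    · rw [union_comm]
      exact hK.rank_lt P fun h' => hne (h'.antisymm h)
    · exact hH.rank_lt P h
  have := P.rank_submodular H K
  have := hH.2
  have := hK.2
  omega

/-- A set of corank one is contained in a hyperplane. -/
theorem exists_isHyperplane {F : Finset (Fin n)} (hF : P.rank F + 1 = P.rank univ) :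
    ∃ H, F ⊆ H ∧ P.IsHyperplane H := by
  classical
  obtain ⟨H, hH, hmax⟩ := exists_max_image
    (univ.filter fun H : Finset (Fin n) => F ⊆ H ∧ P.rank H + 1 = P.rank univ) card
    ⟨F, by simp [hF]⟩
  obtain ⟨hFH, hr⟩ := (mem_filter.1 hH).2
  refine ⟨H, hFH, ?_, hr⟩
  ext x
  simp only [closure, mem_filter, mem_univ, true_and]
  constructor
  · intro hx
    by_contra hxH
    have := hmax (H ∪ {x}) (by
      simp only [mem_filter, mem_univ, true_and, hx, hr, and_true]
      exact hFH.trans subset_union_left)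
    rw [card_union_of_disjoint (by simpa using hxH)] at this
    simp at this
  · intro hx
    rw [union_eq_left.2 (by simpa using hx)]

theorem X_pow_dvd_prod_geomWeight {M : ℕ} {c : Fin n → ℕ} {F : Finset (Fin n)}
    (h : ∀ i ∉ F, c i < M) : (X : ℤ[X]) ^ (n - F.card) ∣ ∏ i, geomWeight M (c i) := by
  classical
  have hcard : n - F.card = (Fᶜ).card := by rw [card_compl, Fintype.card_fin]
  rw [hcard, ← prod_mul_prod_compl F, ← prod_const]
  refine Dvd.dvd.mul_left (prod_dvd_prod_of_dvd _ _ fun i hi => ?_) _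
  rw [geomWeight, if_pos (h i (mem_compl.1 hi))]
  exact dvd_mul_left _ _

open Classical in
/-- Modulo `y ^ m`, only hyperplanes contribute to the probability of not spanning. -/
theorem X_pow_dvd_one_sub_X_pow_mul_exteriorPoly_sub {m : ℕ}
    (hm : ∀ F : Finset (Fin n), P.rank F + 2 ≤ P.rank univ → m ≤ n - F.card) :
    X ^ m ∣ (1 - X) ^ P.rank univ * P.exteriorPoly -
      (1 - ∑ H ∈ univ.filter P.IsHyperplane, X ^ (n - H.card)) := by
  set M := P.rank univ + 1 with hM
  have hH : ∑ H ∈ univ.filter P.IsHyperplane, (X : ℤ[X]) ^ (n - H.card) =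
      ∑ c ∈ box n M, ∑ H ∈ univ.filter P.IsHyperplane,
        if ∀ i ∉ H, c i = 0 then ∏ i, geomWeight M (c i) else 0 := by
    rw [sum_comm]
    refine sum_congr rfl fun H _ => ?_
    rw [← sum_box_filter_support M (by omega) H, sum_filter]
  rw [one_sub_X_pow_mul_exteriorPoly, ← sum_box (n := n) M, hH, sum_filter, ← sum_sub_distrib,
    ← sum_sub_distrib]
  refine dvd_sum fun c _ => ?_
  -- If `c` is below the cutoff off a set of corank at least two, every term is divisible by `X ^
  -- m`. For all other `c` the terms cancel exactly.
  by_cases hex : ∃ F : Finset (Fin n), P.rank F + 2 ≤ P.rank univ ∧ ∀ i ∉ F, c i < M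
  · obtain ⟨F, hF, hc⟩ := hex
    have hd : (X : ℤ[X]) ^ m ∣ ∏ i, geomWeight M (c i) :=
      (pow_dvd_pow X (hm F hF)).trans (X_pow_dvd_prod_geomWeight hc)
    refine dvd_sub ?_ (dvd_sub hd (dvd_sum fun H _ => ?_))
    · split_ifs
      · exact hd
      · exact dvd_zero _
    · split_ifs
      · exact hd
      · exact dvd_zero _
  push Not at hex
  by_cases hs : P.Spanning c
  · rw [if_pos hs, sum_eq_zero]
    · simp [hM]
    · intro H hH
      refine if_neg fun h0 => P.not_spanning_of_lt (F := H) ?_ hs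
      rw [sum_eq_zero fun i hi => h0 i (mem_compl.1 hi)]
      have := (mem_filter.1 hH).2.2
      omega
  · obtain ⟨F, hF⟩ := P.exists_of_not_spanning hs
    have hr : P.rank F + 1 = P.rank univ := by
      by_contra hne
      obtain ⟨i, hi, hci⟩ := hex F (by omega)
      have := single_le_sum (f := c) (fun _ _ => Nat.zero_le _) (mem_compl.2 hi)
      omega
    have h0 : ∀ i ∉ F, c i = 0 := fun i hi => by
      have := single_le_sum (f := c) (fun _ _ => Nat.zero_le _) (mem_compl.2 hi)
      omega
    obtain ⟨H, hFH, hHyp⟩ := P.exists_isHyperplane hr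
    rw [if_neg hs, sum_eq_single_of_mem H (by simp [hHyp]), if_pos fun i hi => h0 i (mt (@hFH i) hi)]
    · simp
    · intro K hK hKH
      refine if_neg fun hK0 => ?_
      -- A second hyperplane `K` would make `c` vanish off `K ∩ H`, a set of corank at least two.
      obtain ⟨i, hi, hci⟩ := hex (K ∩ H) (IsHyperplane.rank_inter P (mem_filter.1 hK).2 hHyp hKH)
      have : c i = 0 := by
        by_cases hiK : i ∈ K
        · exact h0 i fun hiF => hi (mem_inter.2 ⟨hiK, hFH hiF⟩)
        · exact hK0 i hiK
      omega

end IntPolymatroid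

/-! ### Coefficient extraction -/

theorem one_sub_X_pow_mul_mk_multichoose (f : ℕ) :
    (1 - PowerSeries.X) ^ f * PowerSeries.mk (fun m => (Nat.multichoose f m : ℤ)) = 1 := by
  induction f with
  | zero =>
    ext m
    rcases m with _ | m <;> simp [PowerSeries.coeff_one]
  | succ f ih =>
    rw [pow_succ, mul_assoc]
    convert ih using 2
    ext m
    rcases m with _ | m
    · simp
    · rw [sub_mul, one_mul, map_sub, PowerSeries.coeff_succ_X_mul, PowerSeries.coeff_mk,
        PowerSeries.coeff_mk, PowerSeries.coeff_mk, Nat.multichoose_succ_succ]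
      push_cast
      ring

/-- The upper entry is negative only for `f = m = 0`, where both sides are 1. -/
theorem ringChoose_eq_multichoose (f m : ℕ) :
    Ring.choose ((f : ℤ) + m - 1) m = (Nat.multichoose f m : ℤ) := by
  rw [← Ring.multichoose_eq, Nat.multichoose_eq]
  rfl

namespace IntPolymatroid

variable {n : ℕ} (P : IntPolymatroid n)

/-- The low coefficients of the exterior polynomial. -/
theorem coeff_exteriorPoly {i : ℕ} (hi : (i : ℕ∞) < P.r 2) :
    P.exteriorPoly.coeff i =
      Ring.choose ((P.rank univ : ℤ) + i - 1) i -
        ∑ j ∈ range (i + 1), Ring.choose ((P.rank univ : ℤ) + i - 1 - j) (i - j) *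
          ((P.hyperplanes j).card : ℤ) := by
  classical
  have hm : ∀ F : Finset (Fin n), P.rank F + 2 ≤ P.rank univ → i + 1 ≤ n - F.card := by
    intro F hF
    have : (i : ℕ∞) < ((n - F.card : ℕ) : ℕ∞) := hi.trans_le (iInf₂_le F hF)
    exact_mod_cast this
  obtain ⟨Q, hQ⟩ := P.X_pow_dvd_one_sub_X_pow_mul_exteriorPoly_sub hm
  -- `B` is the inverse of `(1 - X) ^ f([n])`.
  set B : PowerSeries ℤ := PowerSeries.mk fun m => (Nat.multichoose (P.rank univ) m : ℤ) with hB
  have hQ' : (1 - PowerSeries.X) ^ P.rank univ * (P.exteriorPoly : PowerSeries ℤ) =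
      1 - ∑ H ∈ univ.filter P.IsHyperplane, PowerSeries.X ^ (n - H.card)
        + PowerSeries.X ^ (i + 1) * (Q : PowerSeries ℤ) := by
    have := congrArg (Polynomial.coeToPowerSeries.ringHom (R := ℤ)) (sub_eq_iff_eq_add'.1 hQ)
    rw [map_mul, map_add, map_sub, map_sum, map_mul] at this
    simpa using this
  have hX : (P.exteriorPoly : PowerSeries ℤ) =
      B - ∑ H ∈ univ.filter P.IsHyperplane, PowerSeries.X ^ (n - H.card) * B
        + PowerSeries.X ^ (i + 1) * ((Q : PowerSeries ℤ) * B) := by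
    calc (P.exteriorPoly : PowerSeries ℤ)
        = ((1 - PowerSeries.X) ^ P.rank univ * B) * (P.exteriorPoly : PowerSeries ℤ) := by
          rw [hB, one_sub_X_pow_mul_mk_multichoose, one_mul]
      _ = ((1 - PowerSeries.X) ^ P.rank univ * (P.exteriorPoly : PowerSeries ℤ)) * B := by ring
      _ = _ := by rw [hQ', ← sum_mul]; ring
  rw [← Polynomial.coeff_coe, hX, map_add, map_sub, map_sum, PowerSeries.coeff_X_pow_mul',
    if_neg (by omega), add_zero, hB, PowerSeries.coeff_mk, ringChoose_eq_multichoose]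
  congr 1
  simp only [PowerSeries.coeff_X_pow_mul', PowerSeries.coeff_mk]
  rw [← sum_filter, ← sum_fiberwise_of_maps_to (t := range (i + 1)) (g := fun H => n - H.card)
    fun H hH => by simpa [Nat.lt_succ_iff] using (mem_filter.1 hH).2]
  refine sum_congr rfl fun j hj => ?_
  have hj : j ≤ i := by simpa [Nat.lt_succ_iff] using hj
  have hset : (filter (fun H => n - H.card = j)
      (filter (fun H => n - H.card ≤ i) (univ.filter P.IsHyperplane))) = P.hyperplanes j := by
    ext H
    simp only [hyperplanes, mem_filter, mem_univ, true_and]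
    constructor
    · rintro ⟨⟨h1, -⟩, h2⟩
      exact ⟨h1, h2⟩
    · rintro ⟨h1, h2⟩
      exact ⟨⟨h1, h2.trans_le hj⟩, h2⟩
  have hc : Ring.choose ((P.rank univ : ℤ) + i - 1 - j) (i - j) =
      (Nat.multichoose (P.rank univ) (i - j) : ℤ) := by
    rw [← ringChoose_eq_multichoose, Nat.cast_sub hj]
    congr 1
    ring
  rw [hc, ← hset, mul_comm, ← nsmul_eq_mul, ← sum_const]
  exact sum_congr rfl fun H hH => by rw [(mem_filter.1 hH).2]

/-! ### Duality and the interior polynomial -/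

theorem rank_le_sum (I : Finset (Fin n)) : P.rank I ≤ ∑ i ∈ I, P.rank {i} := by
  induction I using Finset.induction_on with
  | empty => simp [P.rank_empty]
  | insert i I hi ih =>
    rw [sum_insert hi, insert_eq]
    have := P.rank_submodular {i} I
    omega

theorem rank_univ_le (I : Finset (Fin n)) : P.rank univ ≤ ∑ i ∈ I, P.rank {i} + P.rank Iᶜ := by
  have h1 := P.rank_submodular I Iᶜ
  have h2 := P.rank_le_sum I
  rw [union_compl] at h1
  omega

/-- The dual polymatroid, whose bases are the vectors `d - a` with `a` a basis and
`d i = f {i}`. -/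
def dual : IntPolymatroid n where
  rank I := ∑ i ∈ I, P.rank {i} + P.rank Iᶜ - P.rank univ
  rank_empty := by simp
  rank_mono I J h := by
    have h1 := P.rank_submodular (J \ I) Jᶜ
    have h2 := P.rank_le_sum (J \ I)
    have h3 : J \ I ∪ Jᶜ = Iᶜ := by
      ext x
      have := @h x
      simp only [mem_union, mem_sdiff, mem_compl]
      tauto
    have h4 := sum_sdiff h (f := fun i => P.rank {i})
    rw [h3] at h1
    omega
  rank_submodular I J := by
    have h1 := P.rank_submodular Iᶜ Jᶜ
    have h2 := sum_union_inter (s₁ := I) (s₂ := J) (f := fun i => P.rank {i})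
    have h3 := P.rank_univ_le (I ∪ J)
    have h4 := P.rank_univ_le (I ∩ J)
    have h5 := P.rank_univ_le I
    have h6 := P.rank_univ_le J
    rw [← compl_inter, ← compl_union] at h1
    omega

theorem dual_rank (I : Finset (Fin n)) :
    P.dual.rank I + P.rank univ = ∑ i ∈ I, P.rank {i} + P.rank Iᶜ :=
  Nat.sub_add_cancel (P.rank_univ_le I)

theorem dual_rank_univ : P.dual.rank univ + P.rank univ = ∑ i, P.rank {i} := by
  rw [dual_rank, compl_univ, P.rank_empty, add_zero]

/-- The complementation `a ↦ d - a` exchanging the bases of a polymatroid and its dual. -/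
def dualVec (a : Fin n → ℤ) : Fin n → ℤ := fun i => P.rank {i} - a i

theorem dualVec_dualVec (a : Fin n → ℤ) : P.dualVec (P.dualVec a) = a := by
  ext i
  simp [dualVec]

/-- The dual rank bound on `Iᶜ` is the original bound on `I`; nonnegativity on either side follows
from the other side's rank bounds. -/
theorem dualVec_mem_bases {a : Fin n → ℤ} : P.dualVec a ∈ P.dual.bases ↔ a ∈ P.bases := by
  have hsum : ∀ I : Finset (Fin n),
      ∑ i ∈ I, P.dualVec a i = ∑ i ∈ I, (P.rank {i} : ℤ) - ∑ i ∈ I, a i := fun I => by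
    simp [dualVec]
  have hrank : ∀ I : Finset (Fin n), (P.dual.rank I : ℤ) + P.rank univ =
      ∑ i ∈ I, (P.rank {i} : ℤ) + P.rank Iᶜ := fun I => by exact_mod_cast P.dual_rank I
  have htop : (P.dual.rank univ : ℤ) + P.rank univ = ∑ i, (P.rank {i} : ℤ) := by
    exact_mod_cast P.dual_rank_univ
  simp only [mem_bases, hsum]
  constructor
  · rintro ⟨-, h1, h2⟩
    have hle : ∀ I : Finset (Fin n), ∑ i ∈ I, a i ≤ (P.rank I : ℤ) := fun I => by
      have h3 := h1 Iᶜ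
      have h4 := hrank Iᶜ
      have h5 := sum_add_sum_compl I a
      rw [compl_compl] at h4
      linarith
    refine ⟨fun i => ?_, hle, by linarith⟩
    have h3 := hle {i}ᶜ
    have h4 := sum_add_sum_compl {i} a
    have h5 : (P.rank {i}ᶜ : ℤ) ≤ P.rank univ := by
      exact_mod_cast P.rank_mono _ _ (subset_univ _)
    rw [sum_singleton] at h4
    linarith
  · rintro ⟨-, h1, h2⟩
    refine ⟨fun i => ?_, fun I => ?_, by linarith⟩
    · have := h1 {i}
      rw [sum_singleton] at this
      simpa [dualVec] using this
    · have h3 := h1 Iᶜ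
      have h4 := hrank I
      have h5 := sum_add_sum_compl I a
      linarith

theorem extActive_dual (a : Fin n → ℤ) : P.dual.extActive (P.dualVec a) = P.intActive a := by
  ext i
  simp only [extActive, intActive, mem_filter, mem_univ, true_and]
  refine forall₂_congr fun j _ => not_congr ?_
  rw [← P.dualVec_mem_bases (a := a - e i + e j)]
  have : P.dualVec (a - e i + e j) = P.dualVec a + e i - e j := by
    ext x
    simp only [dualVec, Pi.add_apply, Pi.sub_apply]
    ring
  rw [this]

theorem exteriorPoly_dual : P.dual.exteriorPoly = P.interiorPoly := by
  refine sum_nbij' P.dualVec P.dualVec ?_ ?_ ?_ ?_ ?_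
  · intro a ha
    rw [Set.Finite.mem_toFinset] at ha ⊢
    rwa [← dualVec_mem_bases, dualVec_dualVec]
  · intro a ha
    rw [Set.Finite.mem_toFinset] at ha ⊢
    rwa [dualVec_mem_bases]
  · exact fun a _ => P.dualVec_dualVec a
  · exact fun a _ => P.dualVec_dualVec a
  · intro a _
    rw [← extActive_dual, dualVec_dualVec]

/-- The corank of a set in the dual is the nullity of its complement. -/
theorem dual_corank (F : Finset (Fin n)) :
    P.dual.rank univ + P.rank Fᶜ = P.dual.rank F + ∑ i ∈ Fᶜ, P.rank {i} := by
  have h1 := P.dual_rank_univ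
  have h2 := P.dual_rank F
  have h3 := sum_add_sum_compl F fun i => P.rank {i}
  omega

theorem r_dual_le (k : ℕ) : P.r' k ≤ P.dual.r k := by
  refine le_iInf₂ fun F hF => ?_
  have h := P.dual_corank F
  refine (iInf₂_le Fᶜ (by omega)).trans_eq ?_
  rw [card_compl, Fintype.card_fin]

/-- Dual corank of `H` is nullity of `Hᶜ`. Flatness says that adding any `x ∉ H` kills the corank,
hence that deleting any element of `Hᶜ` kills the nullity. -/
theorem isHyperplane_dual (H : Finset (Fin n)) : P.dual.IsHyperplane H ↔ P.IsCircuit Hᶜ := by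
  have hH := P.dual_corank H
  have hsub : ∀ x ∉ H, Hᶜ \ {x} = (H ∪ {x})ᶜ := fun x _ => by
    rw [compl_union, sdiff_eq_inter_compl]
  constructor
  · rintro ⟨hflat, hr⟩
    refine ⟨by omega, fun x hx => ?_⟩
    have hx : x ∉ H := mem_compl.1 hx
    have hle := IsHyperplane.rank_lt P.dual ⟨hflat, hr⟩ (I := {x}) (by simpa using hx)
    have h1 := P.dual_corank (H ∪ {x})
    have h2 := P.rank_le_sum (H ∪ {x})ᶜ
    rw [hsub x hx]
    omega
  · rintro ⟨h1, h2⟩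
    refine ⟨?_, by omega⟩
    rw [IsFlat]
    ext x
    simp only [closure, mem_filter, mem_univ, true_and]
    constructor
    · intro hx
      by_contra hxH
      have h3 := h2 x (mem_compl.2 hxH)
      have h4 := P.dual_corank (H ∪ {x})
      rw [hsub x hxH] at h3
      omega
    · intro hx
      rw [union_eq_left.2 (by simpa using hx)]

theorem card_hyperplanes_dual (j : ℕ) : (P.dual.hyperplanes j).card = (P.circuits j).card := by
  refine card_nbij' compl compl ?_ ?_ (fun _ _ => compl_compl _) (fun _ _ => compl_compl _)
  · intro H hH
    simp only [hyperplanes, circuits, coe_filter, mem_univ, true_and, Set.mem_ofPred_eq] at hH ⊢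
    rw [← isHyperplane_dual, card_compl, Fintype.card_fin]
    exact hH
  · intro C hC
    simp only [hyperplanes, circuits, coe_filter, mem_univ, true_and, Set.mem_ofPred_eq] at hC ⊢
    rw [isHyperplane_dual, compl_compl, card_compl, Fintype.card_fin]
    have := card_le_univ C
    rw [Fintype.card_fin] at this
    exact ⟨hC.1, by omega⟩

theorem g_eq_dual_rank_univ : P.g = P.dual.rank univ := by
  have h : (P.dual.rank univ : ℤ) + P.rank univ = ∑ i, (P.rank {i} : ℤ) := by
    exact_mod_cast P.dual_rank_univ
  rw [g]
  linarith

/-- The low coefficients of the interior polynomial. -/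
theorem coeff_interiorPoly {i : ℕ} (hi : (i : ℕ∞) < P.r' 2) :
    P.interiorPoly.coeff i =
      Ring.choose (P.g + i - 1) i -
        ∑ j ∈ range (i + 1), Ring.choose (P.g + i - 1 - j) (i - j) *
          ((P.circuits j).card : ℤ) := by
  simp only [← exteriorPoly_dual, P.g_eq_dual_rank_univ, ← card_hyperplanes_dual]
  exact P.dual.coeff_exteriorPoly (hi.trans_le (P.r_dual_le 2))

end IntPolymatroid

theorem theorem3p6 (n : ℕ) (P : IntPolymatroid n) :
    (∀ i : ℕ, (i : ℕ∞) < P.r 2 →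
      P.exteriorPoly.coeff i =
        Ring.choose ((P.rank Finset.univ : ℤ) + i - 1) i -
          ∑ j ∈ Finset.range (i + 1),
            Ring.choose ((P.rank Finset.univ : ℤ) + i - 1 - j) (i - j) *
              ((P.hyperplanes j).card : ℤ)) ∧
    (∀ i : ℕ, (i : ℕ∞) < P.r' 2 →
      P.interiorPoly.coeff i =
        Ring.choose (P.g + i - 1) i -
          ∑ j ∈ Finset.range (i + 1),
            Ring.choose (P.g + i - 1 - j) (i - j) * ((P.circuits j).card : ℤ)) :=
  ⟨fun _ => P.coeff_exteriorPoly, fun _ => P.coeff_interiorPoly⟩
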